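/- Let $\mathbb K$ be an algebraically closed field of characteristic $0$, let $V$ be a $\mathbb K$-vector space of finite dimension $n$, and let $d\ge 1$ and $1\le k<n$ be integers. Let $\mathbb S_{(d^k)}V\subset(\bigwedge^kV)^{\otimes d}$ be the Schur module of the rectangular partition $(d^k)=(d,\dots,d)$ with $k$ rows, that is, the image of the Young symmetrizer which sends $\bigotimes_{i,j}v_{i,j}$ (with $1\le i\le k$, $1\le j\le d$) to $$\sum_{\sigma_1,\dots,\sigma_k\in\mathfrak S_d}\ \bigotimes_{j=1}^d v_{1,\sigma_1(j)}\wedge\dots\wedge v_{k,\sigma_k(j)} .$$ Let $X\subset\mathbb P(\mathbb S_{(d^k)}V)$ be the Grassmannian $\mathbb G(k,V)$ embedded by $\mathcal O(d)$, that is, the set of the points $[(v_1\wedge\dots\wedge v_k)^{\otimes d}]$ with $v_1,\dots,v_k\in V$ linearly independent. The $(d^k)$-rank of a nonzero $t\in\mathbb S_{(d^k)}V$ is the least $r$ such that $[t]$ lies in the linear span of $r$ points of $X$. For $0\le h\le d$ let $$\mathcal C^{(d^k),(h^k)}_t:\ \mathbb S_{(h^k)}V^*\longrightarrow\mathbb S_{(d^k)/(h^k)}V\subset(\textstyle\bigwedge^kV)^{\otimes(d-h)}$$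 be the catalecticant map $g\mapsto\varphi(t\otimes g)$, where $\varphi$ is the Schur apolarity action, that is, the restriction of the bilinear map $$(w_1\otimes\dots\otimes w_d)\otimes(a_1\otimes\dots\otimes a_h)\longmapsto\prod_{j=1}^h\langle a_j,w_j\rangle\cdot w_{h+1}\otimes\dots\otimes w_d ,\qquad \langle\alpha_1\wedge\dots\wedge\alpha_k,\,v_1\wedge\dots\wedge v_k\rangle=\det(\alpha_i(v_j)),$$ with $w_j\in\bigwedge^kV$ and $a_j\in\bigwedge^kV^*$. Let $p\in\mathbb S_{(d^k)}V$ be nonzero. 1. If $p$ has $(d^k)$-rank $1$, then $\operatorname{rk}\mathcal C^{(d^k),(h^k)}_p=1$ for every integer $0\le h\le\lfloor d/2\rfloor$. 2. Conversely, if $d\ge 2$ and $\operatorname{rk}\mathcal C^{(d^k),(h^k)}_p=1$ for every integer $0\le h\le\lfloor d/2\rfloor$, then $p$ has $(d^k)$-rank $1$. 3. For every nonzero $t\in\mathbb S_{(d^k)}V$ and every integer $0\le h\le d$, the $(d^k)$-rank of $t$ is at least $\operatorname{rk}\mathcal C^{(d^k),(h^k)}_t$. -/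

import Mathlib

open scoped TensorProduct LinearAlgebra.Projectivization

noncomputable section

namespace SchurApolarity

/-- A subspace of a tensor power of `⋀^k V` is an additive group, with the usual operations.
(This is the general instance for submodules, which is not found automatically here.) -/
instance instAddCommGroupSubspace {K : Type*} [Field K] {V : Type*} [AddCommGroup V] [Module K V]
    {k : ℕ} {ι : Type*} (S : Submodule K (⨂[K] _ : ι, ⋀[K]^k V)) : AddCommGroup S :=
  @Submodule.addCommGroup K (⨂[K] _ : ι, ⋀[K]^k V) _ _ _ S

/-! ### Schur modules of rectangular shape

The boxes of the Young diagram of `(d^k)` are the pairs `(i, j) : Fin k × Fin d`, where `i` is the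
row and `j` is the column.  All columns have length `k`, so the space `⋀_{λ'} V` that contains the
Schur module is the tensor product of `d` copies of `⋀^k V`, one for every column. -/

section Schur

variable (K : Type*) [Field K] (V : Type*) [AddCommGroup V] [Module K V] (k d : ℕ)

/-- The row symmetrizer of the shape `(d^k)`: the endomorphism of `V^{⊗ (k × d)}` which is the sum
of all permutations of the tensor factors that move every box inside its row. -/
def rowSymmetrizer : (⨂[K] _ : Fin k × Fin d, V) →ₗ[K] (⨂[K] _ : Fin k × Fin d, V) :=
  ∑ σ : Fin k → Equiv.Perm (Fin d),
    (PiTensorProduct.reindex K (fun _ : Fin k × Fin d => V)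
      (Equiv.prodCongrRight σ)).toLinearMap

theorem columns_update {K : Type*} [Field K] {V : Type*} [AddCommGroup V] [Module K V] {k d : ℕ}
    [DecidableEq (Fin k × Fin d)] (v : Fin k × Fin d → V) (b : Fin k × Fin d) (z : V) :
    (fun j : Fin d => exteriorPower.ιMulti K k (fun i => Function.update v b z (i, j))) =
      Function.update (fun j : Fin d => exteriorPower.ιMulti K k (fun i => v (i, j))) b.2
        (exteriorPower.ιMulti K k (Function.update (fun i => v (i, b.2)) b.1 z)) := by
  obtain ⟨i, j⟩ := b
  funext j'
  by_cases hj : j' = j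
  · subst hj
    rw [Function.update_self]
    congr 1
    funext i'
    by_cases hi : i' = i <;> simp [hi]
  · rw [Function.update_of_ne hj]
    congr 1
    funext i'
    simp [hj]

/-- The family `v` of vectors in the boxes is sent to the tensor product over all columns `j` of
the wedge products `v (1, j) ∧ ⋯ ∧ v (k, j)`. -/
def columnWedgeMultilinear :
    MultilinearMap K (fun _ : Fin k × Fin d => V) (⨂[K] _ : Fin d, ⋀[K]^k V) where
  toFun v := ⨂ₜ[K] j : Fin d, exteriorPower.ιMulti K k (fun i => v (i, j))
  map_update_add' v b x y := by
    simp only [columns_update, AlternatingMap.map_update_add, MultilinearMap.map_update_add]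
  map_update_smul' v b c x := by
    simp only [columns_update, AlternatingMap.map_update_smul, MultilinearMap.map_update_smul]

/-- The skew-symmetrization along the columns, with values in `(⋀^k V)^{⊗ d}`. -/
def columnWedge : (⨂[K] _ : Fin k × Fin d, V) →ₗ[K] (⨂[K] _ : Fin d, ⋀[K]^k V) :=
  PiTensorProduct.lift (columnWedgeMultilinear K V k d)

/-- The Schur module `S_{(d^k)} V`, as a subspace of `(⋀^k V)^{⊗ d}`: the image of the Young
symmetrizer, which symmetrizes along the rows and then skew-symmetrizes along the columns. -/
def schurModule : Submodule K (⨂[K] _ : Fin d, ⋀[K]^k V) :=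
  LinearMap.range (columnWedge K V k d ∘ₗ rowSymmetrizer K V k d)

/-- The Grassmannian `𝔾(k, V)`, embedded by `𝒪(d)` in the projective space of `S_{(d^k)} V`: the
points that are represented by the tensors `(v₁ ∧ ⋯ ∧ v_k)^{⊗ d}` with linearly independent
`v₁, …, v_k` in `V`. -/
def grassmannian : Set (ℙ K (schurModule K V k d)) :=
  {p | ∃ v : Fin k → V, LinearIndependent K v ∧
    p.submodule.map (schurModule K V k d).subtype =
      K ∙ (⨂ₜ[K] _ : Fin d, exteriorPower.ιMulti K k v)}

end Schur

/-! ### Additive rank -/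

section Rank

variable {K : Type*} [Field K] {W : Type*} [AddCommGroup W] [Module K W]

/-- The `X`-rank of a point `p` of a projective space: the least `r` such that `p` lies in the
linear span of `r` points of `X` (it is `⊤` if there is no such `r`). -/
def xRank (X : Set (ℙ K W)) (p : ℙ K W) : ℕ∞ :=
  sInf {m : ℕ∞ | ∃ r : ℕ, m = r ∧ ∃ q : Fin r → ℙ K W,
    (∀ i, q i ∈ X) ∧ p.submodule ≤ ⨆ i, (q i).submodule}

end Rank

/-! ### The Schur apolarity action and catalecticants -/

section Apolarity

variable {K : Type*} [Field K] {V : Type*} [AddCommGroup V] [Module K V] {k d h : ℕ}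

/-- The columns of `(d^k)` are the columns of `(h^k)` together with the remaining ones. -/
def columnEquiv (hd : h ≤ d) : Fin h ⊕ {j : Fin d // ¬ (j : ℕ) < h} ≃ Fin d :=
  ((Fin.castLEquiv hd).sumCongr (Equiv.refl _)).trans (Equiv.sumCompl fun j : Fin d => (j : ℕ) < h)

variable (K V k) in
/-- `(⋀^k V)^{⊗ d}` as the tensor product of the first `h` factors with the remaining ones. -/
def splitColumns (hd : h ≤ d) : (⨂[K] _ : Fin d, ⋀[K]^k V) ≃ₗ[K]
    (⨂[K] _ : Fin h, ⋀[K]^k V) ⊗[K]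
      (⨂[K] _ : {j : Fin d // ¬ (j : ℕ) < h}, ⋀[K]^k V) :=
  (PiTensorProduct.reindex K (fun _ : Fin d => ⋀[K]^k V) (columnEquiv hd).symm).trans
    (PiTensorProduct.tmulEquiv K (⋀[K]^k V)).symm

/-- The tensor product of the determinantal pairings `⋀^k V* × ⋀^k V → K`. -/
def columnPairing :
    (⨂[K] _ : Fin h, ⋀[K]^k (Module.Dual K V)) →ₗ[K]
      Module.Dual K (⨂[K] _ : Fin h, ⋀[K]^k V) :=
  PiTensorProduct.dualDistrib ∘ₗ
    PiTensorProduct.map (fun _ : Fin h => exteriorPower.pairingDual K V k)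

/-- The map `C_f : g ↦ φ(f ⊗ g)`, where `φ` is the tensor product of the skew-symmetric apolarity
actions on the columns.  On each of the first `h` columns the action `⋀^k V ⊗ ⋀^k V* → ⋀^0 V = K`
is the determinantal pairing, and on each of the other columns the action
`⋀^k V ⊗ ⋀^0 V* → ⋀^k V` is the identity. -/
def apolarityAction (hd : h ≤ d) (f : ⨂[K] _ : Fin d, ⋀[K]^k V) :
    (⨂[K] _ : Fin h, ⋀[K]^k (Module.Dual K V)) →ₗ[K]
      (⨂[K] _ : {j : Fin d // ¬ (j : ℕ) < h}, ⋀[K]^k V) where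
  toFun g := TensorProduct.lid K _
    (LinearMap.rTensor _ (columnPairing g) (splitColumns K V k hd f))
  map_add' g g' := by simp [LinearMap.rTensor_add]
  map_smul' c g := by simp [LinearMap.rTensor_smul]

/-- The action on decomposable tensors. -/
theorem apolarityAction_tprod (hd : h ≤ d) (w : Fin d → ⋀[K]^k V)
    (a : Fin h → ⋀[K]^k (Module.Dual K V)) :
    apolarityAction hd (⨂ₜ[K] j, w j) (⨂ₜ[K] j, a j) =
      (∏ j : Fin h, exteriorPower.pairingDual K V k (a j) (w (Fin.castLE hd j))) •
        ⨂ₜ[K] j : {j : Fin d // ¬ (j : ℕ) < h}, w j := by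
  have hs : splitColumns K V k hd (⨂ₜ[K] j, w j) =
      (⨂ₜ[K] j : Fin h, w (Fin.castLE hd j)) ⊗ₜ[K]
        (⨂ₜ[K] j : {j : Fin d // ¬ (j : ℕ) < h}, w j) := by
    rw [splitColumns, LinearEquiv.trans_apply, LinearEquiv.symm_apply_eq,
      PiTensorProduct.reindex_tprod, PiTensorProduct.tmulEquiv_apply]
    congr 1
    funext s
    rcases s with s | s <;> rfl
  simp [apolarityAction, hs, columnPairing, PiTensorProduct.map_tprod,
    PiTensorProduct.dualDistrib_apply]

/-- The catalecticant map `C^{(d^k),(h^k)}_f : S_{(h^k)} V* → S_{(d^k)/(h^k)} V`, followed by the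
inclusion of the skew Schur module in the tensor product of one copy of `⋀^k V` for every column of
the skew diagram (this inclusion does not change the rank). -/
def catalecticant (hd : h ≤ d) (f : schurModule K V k d) :
    schurModule K (Module.Dual K V) k h →ₗ[K]
      (⨂[K] _ : {j : Fin d // ¬ (j : ℕ) < h}, ⋀[K]^k V) :=
  apolarityAction hd (f : ⨂[K] _ : Fin d, ⋀[K]^k V) ∘ₗ
    (schurModule K (Module.Dual K V) k h).subtype

end Apolarity

end SchurApolarity

end

open SchurApolarity

namespace SchurApolarity

section

/-! ### Powers of decomposable vectors span the Schur module. -/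

section Polarization

/-! By polarization along the rows, the Schur module is spanned by the powers `w^{⊗d}` of
decomposable `w` (`schurModule_eq_span`). Contracting `w^{⊗d}` with any `g` gives a multiple of
`w^{⊗(d-h)}`, so a combination of `r` powers has a catalecticant of rank at most `r`. For one
nonzero power the rank is exactly 1, since some decomposable form does not vanish on `w`.

The converse needs only `h = 1`. Let `Q a` be the pairing of `p` with a product of decomposable
forms, one for each column. If the first catalecticant has rank one, `Q` splits off its first
argument. As `Q` is symmetric, this gives an exchange law in every column, and `Q a = D * ∏ u (a j)`
follows (`eq_mul_prod_of_exchange`). Plücker relations between two columns are linear in `p` and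
hold for powers, hence for `p`; with `d ≥ 2` they become the quadratic Plücker relations for `u`. So
`u` is evaluation on some `v₁ ∧ ⋯ ∧ v_k`, and nondegeneracy of the pairing gives `p = D • (v₁ ∧ ⋯ ∧
v_k)^{⊗d}`. -/

theorem sum_neg_one_pow_card_compl_of_subset {α R : Type*} [Fintype α] [DecidableEq α]
    [CommRing R] (A : Finset α) :
    ∑ S : Finset α, (if A ⊆ S then (-1 : R) ^ Sᶜ.card else 0) =
      if A = Finset.univ then 1 else 0 := by
  -- Complementation gives the alternating sum over subsets of `Aᶜ`, which vanishes unless `Aᶜ` is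
  -- empty.
  have h1 : ∑ S : Finset α, (if A ⊆ S then (-1 : R) ^ Sᶜ.card else 0) =
      ∑ T : Finset α, if T ⊆ Aᶜ then (-1 : R) ^ T.card else 0 := by
    refine Fintype.sum_equiv (compl_involutive.toPerm (compl : Finset α → Finset α)) _ _ fun S => ?_
    simp
  have h2 := congrArg (Int.cast : ℤ → R) (Finset.sum_powerset_neg_one_pow_card (x := Aᶜ))
  rw [h1, ← Finset.sum_filter]
  have h3 : Finset.univ.filter (fun T : Finset α => T ⊆ Aᶜ) = Aᶜ.powerset := by
    ext; simp
  rw [h3]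
  simpa [Finset.compl_eq_empty_iff] using h2

variable {K : Type*} [Field K] {V N : Type*} [AddCommGroup V] [Module K V]
  [AddCommMonoid N] [Module K N] {k d : ℕ}

/-- Polarization in every row: the symmetrization of a multilinear map along the rows is an
alternating sum of values at families that are constant along the rows. -/
theorem sum_perm_rows_eq (f : MultilinearMap K (fun _ : Fin k × Fin d => V) N)
    (v : Fin k × Fin d → V) :
    ∑ σ : Fin k → Equiv.Perm (Fin d), f (fun b => v (b.1, σ b.1 b.2)) =
      ∑ S : Fin k → Finset (Fin d), (∏ i, (-1 : K) ^ (S i)ᶜ.card) •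
        f (fun b => ∑ l ∈ S b.1, v (b.1, l)) := by
  have h1 (S : Fin k → Finset (Fin d)) : f (fun b => ∑ l ∈ S b.1, v (b.1, l)) =
      ∑ r : Fin k × Fin d → Fin d,
        (∏ i, if Finset.univ.image (fun j => r (i, j)) ⊆ S i then (1 : K) else 0) •
          f (fun b => v (b.1, r b)) := by
    rw [f.map_sum_finset (fun b l => v (b.1, l)) (fun b => S b.1)]
    have : ∀ r : Fin k × Fin d → Fin d, r ∈ Fintype.piFinset (fun b : Fin k × Fin d => S b.1) ↔
        ∀ i, Finset.univ.image (fun j => r (i, j)) ⊆ S i := by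
      intro r
      simp [Fintype.mem_piFinset, Finset.image_subset_iff]
    simp_rw [Fintype.prod_ite_zero, ite_smul, Finset.prod_const_one, one_smul, zero_smul,
      ← this, Finset.sum_ite_mem, Finset.univ_inter]
  simp_rw [h1, Finset.smul_sum, smul_smul, ← Finset.prod_mul_distrib]
  rw [Finset.sum_comm]
  simp_rw [← Finset.sum_smul]
  -- The signed sum factors over the rows. Inclusion–exclusion kills every `r` that misses a value
  -- in some row; the survivors are the row permutations.
  have h2 (r : Fin k × Fin d → Fin d) :
      (∑ S : Fin k → Finset (Fin d), ∏ i, (-1 : K) ^ (S i)ᶜ.card *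
        (if Finset.univ.image (fun j => r (i, j)) ⊆ S i then (1 : K) else 0)) =
      if ∀ i, Function.Surjective (fun j => r (i, j)) then 1 else 0 := by
    have h3 := Finset.prod_univ_sum (fun _ : Fin k => (Finset.univ : Finset (Finset (Fin d))))
      (fun i S => (-1 : K) ^ Sᶜ.card *
        (if Finset.univ.image (fun j => r (i, j)) ⊆ S then (1 : K) else 0))
    rw [Fintype.piFinset_univ] at h3
    rw [← h3]
    simp_rw [mul_ite, mul_one, mul_zero, sum_neg_one_pow_card_compl_of_subset,
      Fintype.prod_ite_zero, Finset.prod_const_one, Finset.eq_univ_iff_forall,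
      Finset.mem_image, Finset.mem_univ, true_and, Function.Surjective]
    congr
  simp_rw [h2, ite_smul, one_smul, zero_smul]
  refine Finset.sum_of_injOn (fun σ b => σ b.1 b.2) ?_ (by simp) ?_ ?_
  · intro σ _ τ _ h
    funext i
    ext j
    exact congrArg Fin.val (congrFun h (i, j))
  · intro r _ hr
    rw [if_neg]
    intro hs
    refine hr ⟨fun i => Equiv.ofBijective _ ((hs i).bijective_of_finite), by simp, ?_⟩
    funext b
    simp
  · intro σ _
    rw [if_pos fun i => (σ i).surjective]

theorem columnWedge_rowSymmetrizer_tprod (v : Fin k × Fin d → V) :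
    columnWedge K V k d (rowSymmetrizer K V k d (⨂ₜ[K] b, v b)) =
      ∑ σ : Fin k → Equiv.Perm (Fin d),
        columnWedgeMultilinear K V k d (fun b => v (b.1, σ b.1 b.2)) := by
  simp only [rowSymmetrizer, LinearMap.sum_apply, map_sum, LinearEquiv.coe_coe,
    PiTensorProduct.reindex_tprod, columnWedge, PiTensorProduct.lift.tprod]
  -- Reindexing a tensor evaluates the family at the inverse permutation.
  refine Fintype.sum_equiv (Equiv.inv _) _ _ fun σ => ?_
  rfl

/-- The Young symmetrizer sends a family constant along rows to this power times the number of row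
permutations, which is invertible in characteristic zero. -/
theorem tprod_ιMulti_mem_schurModule [CharZero K] (v : Fin k → V) :
    (⨂ₜ[K] _ : Fin d, exteriorPower.ιMulti K k v) ∈ schurModule K V k d := by
  have h := columnWedge_rowSymmetrizer_tprod (K := K) (d := d) (fun b : Fin k × Fin d => v b.1)
  simp only [Finset.sum_const] at h
  have h0 : (((Finset.univ : Finset (Fin k → Equiv.Perm (Fin d))).card : ℕ) : K) ≠ 0 :=
    Nat.cast_ne_zero.2 (Finset.card_pos.2 Finset.univ_nonempty).ne'
  rw [← Nat.cast_smul_eq_nsmul K] at h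
  rw [← Submodule.smul_mem_iff _ h0]
  exact ⟨_, h⟩

/-- The Schur module of `(d^k)` is spanned by the `d`-th powers of decomposable vectors. -/
theorem schurModule_eq_span [CharZero K] : schurModule K V k d =
    Submodule.span K (Set.range fun v : Fin k → V =>
      ⨂ₜ[K] _ : Fin d, exteriorPower.ιMulti K k v) := by
  apply le_antisymm
  · rw [schurModule, LinearMap.range_eq_map, ← PiTensorProduct.span_tprod_eq_top,
      Submodule.map_span, Submodule.span_le]
    rintro _ ⟨_, ⟨v, rfl⟩, rfl⟩
    rw [LinearMap.comp_apply, columnWedge_rowSymmetrizer_tprod, sum_perm_rows_eq]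
    exact Submodule.sum_mem _ fun S _ => Submodule.smul_mem _ _
      (Submodule.subset_span ⟨fun i => ∑ l ∈ S i, v (i, l), rfl⟩)
  · rw [Submodule.span_le]
    rintro _ ⟨v, rfl⟩
    exact tprod_ιMulti_mem_schurModule v

end Polarization

section Multiplicative

/-! ### Symmetric functions of rank one -/

variable {K X ι : Type*} [Field K] [Fintype ι] [DecidableEq ι] {Q : (ι → X) → K}

/-- Entries are replaced by `b i` one at a time. Exchanging slot `j` between `c` and its copy with
`i` and `j` swapped exhibits `Q c * Q c ≠ 0` as a multiple of `Q` at the new family. -/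
theorem apply_const_ne_zero_of_exchange
    (hsymm : ∀ (σ : Equiv.Perm ι) a, Q (a ∘ σ) = Q a)
    (hexch : ∀ a b j, Q a * Q b = Q (Function.update a j (b j)) * Q (Function.update b j (a j)))
    {b : ι → X} (hb : Q b ≠ 0) (i : ι) : Q (fun _ => b i) ≠ 0 := by
  suffices h : ∀ s : Finset ι, Q (s.piecewise (fun _ => b i) b) ≠ 0 by
    simpa using h Finset.univ
  intro s
  induction s using Finset.induction_on with
  | empty => simpa using hb
  | insert j s hj ih =>
    rw [Finset.piecewise_insert]
    set c := s.piecewise (fun _ => b i) b with hc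
    have hci : c i = b i := by
      by_cases his : i ∈ s <;> simp [hc, his]
    have h := hexch (c ∘ Equiv.swap i j) c j
    rw [hsymm, Function.comp_apply, Equiv.swap_apply_right, hci] at h
    exact right_ne_zero_of_mul (h ▸ mul_ne_zero ih ih)

/-- Exchanging slot `j` with the constant family `x` pulls out the factor belonging to `a j`; by
symmetry the factor can be computed in the fixed slot `i`. -/
theorem eq_mul_prod_of_exchange
    (hsymm : ∀ (σ : Equiv.Perm ι) a, Q (a ∘ σ) = Q a)
    (hexch : ∀ a b j, Q a * Q b = Q (Function.update a j (b j)) * Q (Function.update b j (a j)))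
    {x : X} (hx : Q (fun _ => x) ≠ 0) (i : ι) (a : ι → X) :
    Q a = Q (fun _ => x) *
      ∏ j, Q (Function.update (fun _ => x) i (a j)) / Q (fun _ => x) := by
  suffices h : ∀ s : Finset ι, Q a = Q (s.piecewise (fun _ => x) a) *
      ∏ j ∈ s, Q (Function.update (fun _ => x) i (a j)) / Q (fun _ => x) by
    simpa using h Finset.univ
  intro s
  induction s using Finset.induction_on with
  | empty => simp
  | insert j s hj ih =>
    rw [ih, Finset.piecewise_insert, Finset.prod_insert hj, ← mul_assoc]
    congr 1
    have h := hexch (s.piecewise (fun _ => x) a) (fun _ => x) j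
    have hs : Q (Function.update (fun _ => x) j (a j)) =
        Q (Function.update (fun _ => x) i (a j)) := by
      rw [← hsymm (Equiv.swap i j)]
      congr 1
      funext l
      simp only [Function.comp_apply, Function.update_apply]
      congr 1
      rw [Equiv.swap_apply_eq_iff, Equiv.swap_apply_right]
    rw [Finset.piecewise_eq_of_notMem _ _ _ hj, hs] at h
    field_simp
    exact h

end Multiplicative

section Pluecker

/-! ### Plücker relations -/

variable {K : Type*} [Field K] {E : Type*} [AddCommGroup E] [Module K E] {k : ℕ}

/-- The Plücker exchange relation between maximal minors. -/
theorem det_mul_det_eq_sum_exchange {n R : Type*} [Fintype n] [DecidableEq n] [CommRing R]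
    (A B : Matrix n n R) (j : n) :
    A.det * B.det = ∑ i, (A.updateCol i (B.col j)).det * (B.updateCol j (A.col i)).det := by
  have h1 : Matrix.cramer B (A.det • B.col j) j = A.det * B.det := by
    rw [map_smul, Pi.smul_apply, Matrix.cramer_apply, smul_eq_mul]
    congr 2
    exact Matrix.updateCol_eq_self B j
  -- Cramer's rule for `A` expands `A.det • B.col j` in the columns of `A`; linearity of `B.cramer`
  -- does the rest.
  rw [← h1, ← Matrix.mulVec_cramer, Matrix.mulVec_eq_sum, map_sum, Finset.sum_apply]
  refine Finset.sum_congr rfl fun i _ => ?_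
  rw [op_smul_eq_smul, map_smul, Pi.smul_apply, Matrix.cramer_apply, Matrix.cramer_apply,
    smul_eq_mul]
  rfl

/-- An alternating form that satisfies the Plücker exchange relations is decomposable. -/
theorem alternatingMap_eq_det_of_exchange (f : E [⋀^Fin k]→ₗ[K] K) {α : Fin k → E}
    (hα : f α = 1)
    (hf : ∀ β j, f α * f β =
      ∑ i, f (Function.update α i (β j)) * f (Function.update β j (α i))) (β : Fin k → E) :
    f β = (Matrix.of fun i j => f (Function.update α i (β j))).det := by
  let T : E →ₗ[K] (Fin k → K) := LinearMap.pi fun i => f.toMultilinearMap.toLinearMap α i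
  have hT (x : E) (i : Fin k) : T x i = f (Function.update α i x) := rfl
  let G : (Fin k → K) →ₗ[K] E := Fintype.linearCombination K α
  -- Each exchange relation replaces `β j` by its image `G (T (β j))` in the span of `α`. Thus `f`
  -- is pulled back along `T` from `K^k`, where an alternating `k`-form is a multiple of the
  -- determinant.
  have key (s : Finset (Fin k)) : f β = f (s.piecewise (fun j => G (T (β j))) β) := by
    induction s using Finset.induction_on with
    | empty => simp
    | insert j s hj ih =>
      rw [ih, Finset.piecewise_insert]
      have h := hf (s.piecewise (fun j => G (T (β j))) β) j
      rw [hα, one_mul, Finset.piecewise_eq_of_notMem _ _ _ hj] at h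
      rw [h, Fintype.linearCombination_apply, AlternatingMap.map_update_sum]
      simp [hT]
  have h := congrArg (fun g : (Fin k → K) [⋀^Fin k]→ₗ[K] K => g fun j => T (β j))
    ((f.compLinearMap G).eq_smul_basis_det (Pi.basisFun K (Fin k)))
  have hG : (fun i => G (Pi.basisFun K (Fin k) i)) = α := by
    funext i
    simp [G, Fintype.linearCombination_apply_single]
  have h2 : (f.compLinearMap G) (Pi.basisFun K (Fin k)) = 1 := by
    rw [← hα, ← hG]
    rfl
  rw [h2, one_smul, Pi.basisFun_det_apply] at h
  have h3 := key Finset.univ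
  rw [Finset.piecewise_univ] at h3
  rw [h3]
  refine h.trans ?_
  rw [← Matrix.det_transpose]
  rfl

end Pluecker

variable {K : Type*} [Field K] {V : Type*} [AddCommGroup V] [Module K V] {k d h : ℕ}

section Pairing

/-! ### Nondegeneracy of the pairings -/

theorem columnPairing_tprod_tprod (a : Fin h → ⋀[K]^k (Module.Dual K V)) (w : Fin h → ⋀[K]^k V) :
    columnPairing (⨂ₜ[K] j, a j) (⨂ₜ[K] j, w j) =
      ∏ j, exteriorPower.pairingDual K V k (a j) (w j) := by
  simp [columnPairing, PiTensorProduct.map_tprod, PiTensorProduct.dualDistrib_apply]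

/-- The coordinates of `p` in the product basis are themselves pairings with products of
decomposable forms. -/
theorem exists_columnPairing_ne_zero [FiniteDimensional K V] {p : ⨂[K] _ : Fin d, ⋀[K]^k V}
    (hp : p ≠ 0) : ∃ α : Fin d → Fin k → Module.Dual K V,
      columnPairing (⨂ₜ[K] j, exteriorPower.ιMulti K k (α j)) p ≠ 0 := by
  by_contra! H
  refine hp ?_
  let b := Module.finBasis K V
  refine (Basis.piTensorProduct fun _ : Fin d => b.exteriorPower k).ext_elem fun s => ?_
  have hs : (Basis.piTensorProduct fun _ : Fin d => b.exteriorPower k).coord s =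
      columnPairing (⨂ₜ[K] j, exteriorPower.ιMulti_family K k b.coord (s j)) := by
    refine PiTensorProduct.ext (MultilinearMap.ext fun w => ?_)
    simp only [LinearMap.compMultilinearMap_apply, Module.Basis.coord_apply,
      Basis.piTensorProduct_repr_tprod_apply, columnPairing_tprod_tprod,
      exteriorPower.basis_repr_apply]
    rfl
  rw [map_zero, Finsupp.zero_apply, ← Module.Basis.coord_apply, hs]
  exact H _

theorem exists_pairingDual_ne_zero [FiniteDimensional K V] {w : ⋀[K]^k V} (hw : w ≠ 0) :
    ∃ α : Fin k → Module.Dual K V,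
      exteriorPower.pairingDual K V k (exteriorPower.ιMulti K k α) w ≠ 0 := by
  by_contra! H
  refine hw (((Module.finBasis K V).exteriorPower k).ext_elem fun s => ?_)
  rw [exteriorPower.basis_repr_apply, map_zero]
  exact H _

/-- The contraction of the first `h` columns with `g`, as a linear map. -/
noncomputable def columnContraction (hd : h ≤ d) (g : ⨂[K] _ : Fin h, ⋀[K]^k (Module.Dual K V)) :
    (⨂[K] _ : Fin d, ⋀[K]^k V) →ₗ[K] (⨂[K] _ : {j : Fin d // ¬ (j : ℕ) < h}, ⋀[K]^k V) :=
  (TensorProduct.lid K _).toLinearMap ∘ₗ LinearMap.rTensor _ (columnPairing g) ∘ₗ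
    (splitColumns K V k hd).toLinearMap

theorem columnContraction_apply (hd : h ≤ d) (g : ⨂[K] _ : Fin h, ⋀[K]^k (Module.Dual K V))
    (f : ⨂[K] _ : Fin d, ⋀[K]^k V) :
    columnContraction hd g f = apolarityAction hd f g := rfl

theorem apolarityAction_tprod_const (hd : h ≤ d) (w : ⋀[K]^k V)
    (g : ⨂[K] _ : Fin h, ⋀[K]^k (Module.Dual K V)) :
    apolarityAction hd (⨂ₜ[K] _, w) g = columnPairing g (⨂ₜ[K] _, w) • ⨂ₜ[K] _, w := by
  have : apolarityAction hd (⨂ₜ[K] _, w) =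
      ((columnPairing (K := K) (V := V) (k := k) (h := h)).flip (⨂ₜ[K] _, w)).smulRight
        (⨂ₜ[K] _ : {j : Fin d // ¬ (j : ℕ) < h}, w) := by
    refine PiTensorProduct.ext (MultilinearMap.ext fun a => ?_)
    simp [apolarityAction_tprod, columnPairing_tprod_tprod]
  rw [this]
  rfl

/-- The complete contraction with decomposable tensors can be done in two steps. -/
theorem columnPairing_tprod_eq (hd : h ≤ d) (a : Fin d → ⋀[K]^k (Module.Dual K V))
    (p : ⨂[K] _ : Fin d, ⋀[K]^k V) :
    columnPairing (⨂ₜ[K] j, a j) p =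
      PiTensorProduct.dualDistrib (⨂ₜ[K] j : {j : Fin d // ¬ (j : ℕ) < h},
        exteriorPower.pairingDual K V k (a j))
        (apolarityAction hd p (⨂ₜ[K] j : Fin h, a (Fin.castLE hd j))) := by
  rw [← columnContraction_apply, ← LinearMap.comp_apply]
  congr 1
  refine PiTensorProduct.ext (MultilinearMap.ext fun w => ?_)
  simp only [LinearMap.compMultilinearMap_apply, LinearMap.comp_apply, columnContraction_apply,
    apolarityAction_tprod, map_smul, PiTensorProduct.dualDistrib_apply, columnPairing_tprod_tprod,
    smul_eq_mul]
  rw [← Fintype.prod_equiv (columnEquiv hd) _ _ fun _ => rfl, Fintype.prod_sum_type]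
  rfl

end Pairing

/-! ### Symmetry and Plücker relations on the Schur module. -/

section Symmetric

variable [CharZero K]

/-- Both sides are linear in `p` and agree on the spanning powers. -/
theorem columnPairing_comp_perm {p : ⨂[K] _ : Fin d, ⋀[K]^k V} (hp : p ∈ schurModule K V k d)
    (σ : Equiv.Perm (Fin d)) (a : Fin d → ⋀[K]^k (Module.Dual K V)) :
    columnPairing (⨂ₜ[K] j, a (σ j)) p = columnPairing (⨂ₜ[K] j, a j) p := by
  rw [schurModule_eq_span] at hp
  refine LinearMap.eqOn_span ?_ hp
  rintro _ ⟨v, rfl⟩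
  simp only [columnPairing_tprod_tprod]
  exact Equiv.prod_comp σ fun j =>
    exteriorPower.pairingDual K V k (a j) (exteriorPower.ιMulti K k v)

theorem prod_update_update {ι X R : Type*} [Fintype ι] [DecidableEq ι] [CommMonoid R]
    (φ : X → R) {i j : ι} (hij : i ≠ j) (a : ι → X) (x y : X) :
    ∏ l, φ (Function.update (Function.update a i x) j y l) =
      φ x * φ y * ∏ l ∈ (Finset.univ.erase i).erase j, φ (a l) := by
  rw [← Finset.mul_prod_erase _ _ (Finset.mem_univ i),
    ← Finset.mul_prod_erase _ _ (Finset.mem_erase.2 ⟨hij.symm, Finset.mem_univ j⟩), ← mul_assoc]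
  congr 1
  · simp [Function.update_of_ne hij]
  · refine Finset.prod_congr rfl fun l hl => ?_
    simp only [Finset.mem_erase] at hl
    rw [Function.update_of_ne hl.1, Function.update_of_ne hl.2.1]

/-- The tensors of the Schur module satisfy the Plücker relations in every two columns. -/
theorem columnPairing_exchange {p : ⨂[K] _ : Fin d, ⋀[K]^k V} (hp : p ∈ schurModule K V k d)
    {i j : Fin d} (hij : i ≠ j) (a : Fin d → Fin k → Module.Dual K V)
    (α β : Fin k → Module.Dual K V) (l : Fin k) :
    columnPairing (⨂ₜ[K] m, exteriorPower.ιMulti K k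
      (Function.update (Function.update a i α) j β m)) p =
    ∑ s, columnPairing (⨂ₜ[K] m, exteriorPower.ιMulti K k
      (Function.update (Function.update a i (Function.update α s (β l))) j
        (Function.update β l (α s)) m)) p := by
  rw [schurModule_eq_span] at hp
  rw [← LinearMap.sum_apply]
  refine LinearMap.eqOn_span ?_ hp
  rintro _ ⟨v, rfl⟩
  simp only [LinearMap.sum_apply, columnPairing_tprod_tprod]
  have h (x y : Fin k → Module.Dual K V) := prod_update_update (fun x => exteriorPower.pairingDual
    K V k (exteriorPower.ιMulti K k x) (exteriorPower.ιMulti K k v)) hij a x y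
  simp only [h, ← Finset.sum_mul]
  simp only [exteriorPower.pairingDual_ιMulti_ιMulti]
  congr 1
  rw [det_mul_det_eq_sum_exchange _ _ l]
  refine Finset.sum_congr rfl fun s _ => ?_
  congr 2 <;>
  · ext r c
    simp only [Matrix.updateCol_apply, Matrix.of_apply, Function.update_apply, Matrix.col_apply]
    split_ifs <;> rfl

end Symmetric

/-! ### Rank one of the first catalecticant forces a power. -/

section RankOne

variable [CharZero K] [FiniteDimensional K V]

omit [CharZero K] [FiniteDimensional K V] in
theorem exists_eq_smul_of_finrank_range_eq_one {A B : Type*} [AddCommMonoid A] [Module K A]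
    [AddCommMonoid B] [Module K B] (f : A →ₗ[K] B)
    (hf : Module.finrank K (LinearMap.range f) = 1) : ∃ q, ∀ x, ∃ c : K, f x = c • q := by
  let _ : AddCommGroup B := Module.addCommMonoidToAddCommGroup K
  obtain ⟨q, -, hq⟩ := finrank_eq_one_iff'.1 hf
  refine ⟨q, fun x => ?_⟩
  obtain ⟨c, hc⟩ := hq ⟨f x, x, rfl⟩
  exact ⟨c, (congrArg Subtype.val hc).symm⟩

omit [FiniteDimensional K V] in
-- The pairing is a scalar depending on the first column times a function of the others, so first
-- columns can be exchanged. Symmetry carries this to column `j`.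
theorem columnPairing_exchange_of_finrank_eq_one (hd : 1 ≤ d) (p : schurModule K V k d)
    (h1 : Module.finrank K (LinearMap.range (catalecticant hd p)) = 1)
    (a b : Fin d → Fin k → Module.Dual K V) (j : Fin d) :
    columnPairing (⨂ₜ[K] m, exteriorPower.ιMulti K k (a m)) p.1 *
      columnPairing (⨂ₜ[K] m, exteriorPower.ιMulti K k (b m)) p.1 =
    columnPairing (⨂ₜ[K] m, exteriorPower.ιMulti K k (Function.update a j (b j) m)) p.1 *
      columnPairing (⨂ₜ[K] m, exteriorPower.ιMulti K k (Function.update b j (a j) m)) p.1 := by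
  obtain ⟨q, hq⟩ := exists_eq_smul_of_finrank_range_eq_one _ h1
  have hc (α : Fin k → Module.Dual K V) : ∃ c : K,
      apolarityAction hd p.1 (⨂ₜ[K] _, exteriorPower.ιMulti K k α) = c • q :=
    hq ⟨_, tprod_ιMulti_mem_schurModule (d := 1) α⟩
  choose c hc using hc
  let z : Fin d := ⟨0, hd⟩
  have hcast (m : Fin 1) : Fin.castLE hd m = z := by
    ext
    simp [z]
  have hval (a : Fin d → Fin k → Module.Dual K V) :
      columnPairing (⨂ₜ[K] m, exteriorPower.ιMulti K k (a m)) p.1 = c (a z) *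
      PiTensorProduct.dualDistrib (⨂ₜ[K] m : {m : Fin d // ¬ (m : ℕ) < 1},
        exteriorPower.pairingDual K V k (exteriorPower.ιMulti K k (a m))) q := by
    rw [columnPairing_tprod_eq hd]
    simp only [hcast, hc, map_smul, smul_eq_mul]
  have hrest (a : Fin d → Fin k → Module.Dual K V) (x) (m : {m : Fin d // ¬ (m : ℕ) < 1}) :
      Function.update a z x m = a m :=
    Function.update_of_ne (fun h => m.2 (by simp [h, z])) _ _
  have hz (a b : Fin d → Fin k → Module.Dual K V) :
      columnPairing (⨂ₜ[K] m, exteriorPower.ιMulti K k (a m)) p.1 *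
        columnPairing (⨂ₜ[K] m, exteriorPower.ιMulti K k (b m)) p.1 =
      columnPairing (⨂ₜ[K] m, exteriorPower.ιMulti K k (Function.update a z (b z) m)) p.1 *
        columnPairing (⨂ₜ[K] m, exteriorPower.ιMulti K k (Function.update b z (a z) m)) p.1 := by
    simp only [hval, hrest, Function.update_self]
    ring
  have hsw (a : Fin d → Fin k → Module.Dual K V) :
      columnPairing (⨂ₜ[K] m, exteriorPower.ιMulti K k (a (Equiv.swap z j m))) p.1 =
        columnPairing (⨂ₜ[K] m, exteriorPower.ιMulti K k (a m)) p.1 :=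
    columnPairing_comp_perm p.2 (Equiv.swap z j) fun m => exteriorPower.ιMulti K k (a m)
  have hup (a : Fin d → Fin k → Module.Dual K V) (x) :
      Function.update (fun m => a (Equiv.swap z j m)) z x =
        fun m => Function.update a j x (Equiv.swap z j m) := by
    funext m
    simp only [Function.update_apply, Equiv.swap_apply_eq_iff, Equiv.swap_apply_right]
  have h := hz (fun m => a (Equiv.swap z j m)) (fun m => b (Equiv.swap z j m))
  rw [hup, hup] at h
  simpa only [hsw, Equiv.swap_apply_left] using h

/-- If the first catalecticant has rank one, then the tensor is a multiple of a power of a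
decomposable vector. -/
theorem exists_eq_smul_tprod_ιMulti (hd : 2 ≤ d) (p : schurModule K V k d) (hp : p ≠ 0)
    (h1 : Module.finrank K (LinearMap.range (catalecticant (one_le_two.trans hd) p)) = 1) :
    ∃ (c : K) (v : Fin k → V), p.1 = c • ⨂ₜ[K] _ : Fin d, exteriorPower.ιMulti K k v := by
  let Q (a : Fin d → Fin k → Module.Dual K V) : K :=
    columnPairing (⨂ₜ[K] m, exteriorPower.ιMulti K k (a m)) p.1
  have hsymm (σ : Equiv.Perm (Fin d)) (a) : Q (a ∘ σ) = Q a :=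
    columnPairing_comp_perm p.2 σ fun m => exteriorPower.ιMulti K k (a m)
  have hexch (a b j) : Q a * Q b = Q (Function.update a j (b j)) * Q (Function.update b j (a j)) :=
    columnPairing_exchange_of_finrank_eq_one _ p h1 a b j
  let z : Fin d := ⟨0, two_pos.trans_le hd⟩
  let o : Fin d := ⟨1, hd⟩
  have hzo : z ≠ o := by simp [z, o]
  obtain ⟨b, hb⟩ := exists_columnPairing_ne_zero fun h => hp (Subtype.ext h)
  have hD : Q (fun _ => b z) ≠ 0 := apply_const_ne_zero_of_exchange hsymm hexch hb z
  have hQ := eq_mul_prod_of_exchange hsymm hexch hD z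
  set α := b z
  set D := Q fun _ => α with hDdef
  -- The variable form sits in column `z`, with `α` in all other columns; dividing by `D` gives `u α
  -- = 1`.
  let u : Module.Dual K V [⋀^Fin k]→ₗ[K] K :=
    ((D⁻¹ • ((columnPairing.flip p.1).compMultilinearMap (PiTensorProduct.tprod K)).toLinearMap
      (fun _ => exteriorPower.ιMulti K k α) z)).compAlternatingMap (exteriorPower.ιMulti K k)
  have hu (β) : u β = Q (Function.update (fun _ => α) z β) / D := by
    rw [div_eq_inv_mul]
    simp only [u, Q, LinearMap.compAlternatingMap_apply, LinearMap.smul_apply, smul_eq_mul]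
    congr 1
    simp only [MultilinearMap.toLinearMap_apply, LinearMap.compMultilinearMap_apply,
      LinearMap.flip_apply]
    congr 3
    funext m
    by_cases hm : m = z
    · subst hm; simp
    · simp [hm]
  have huα : u α = 1 := by
    rw [hu, Function.update_eq_self_iff.2 rfl]
    exact div_self hD
  simp only [← hu] at hQ
  have hQ2 (β γ) : Q (Function.update (Function.update (fun _ => α) z β) o γ) =
      D * (u β * u γ) := by
    rw [hQ, prod_update_update u hzo, Finset.prod_eq_one fun _ _ => huα, mul_one]
  -- The Plücker relation of `p` in the two distinct columns `z` and `o`, divided by `D`.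
  have hexu (β j) : u α * u β =
      ∑ i, u (Function.update α i (β j)) * u (Function.update β j (α i)) := by
    have h := columnPairing_exchange p.2 hzo (fun _ => α) α β j
    change Q _ = ∑ s, Q _ at h
    simp only [hQ2, ← Finset.mul_sum] at h
    exact mul_left_cancel₀ hD h
  -- By reflexivity, each functional `u (Function.update α i ·)` on the dual is evaluation at a
  -- vector.
  let v (i : Fin k) : V := (Module.evalEquiv K V).symm (u.toMultilinearMap.toLinearMap α i)
  have hv (i : Fin k) (β : Module.Dual K V) : β (v i) = u (Function.update α i β) := by
    rw [Module.apply_evalEquiv_symm_apply]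
    rfl
  refine ⟨D, v, ?_⟩
  by_contra hne
  obtain ⟨a, ha⟩ := exists_columnPairing_ne_zero (sub_ne_zero.2 hne)
  refine ha ?_
  rw [map_sub, map_smul, columnPairing_tprod_tprod, sub_eq_zero]
  refine (hQ a).trans ?_
  rw [smul_eq_mul]
  congr 1
  refine Finset.prod_congr rfl fun j _ => ?_
  rw [alternatingMap_eq_det_of_exchange u huα hexu, exteriorPower.pairingDual_ιMulti_ιMulti]
  simp only [hv]

end RankOne

/-! ### Grassmannian rank against catalecticant rank. -/

section Rank

theorem one_le_xRank {W : Type*} [AddCommGroup W] [Module K W] (X : Set (ℙ K W)) (p : ℙ K W) :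
    1 ≤ xRank X p := by
  refine le_sInf ?_
  rintro _ ⟨r, rfl, q, -, hq⟩
  rw [Nat.one_le_cast, Nat.one_le_iff_ne_zero]
  rintro rfl
  rw [iSup_of_empty, le_bot_iff] at hq
  have := p.finrank_submodule
  rw [hq, finrank_bot] at this
  exact zero_ne_one this

theorem xRank_eq_one_of_mem {W : Type*} [AddCommGroup W] [Module K W] {X : Set (ℙ K W)}
    {p : ℙ K W} (hp : p ∈ X) : xRank X p = 1 := by
  refine le_antisymm (sInf_le ⟨1, by simp, fun _ => p, fun _ => hp, ?_⟩) (one_le_xRank X p)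
  exact le_iSup (fun _ : Fin 1 => p.submodule) 0

theorem mk_mem_grassmannian {p : schurModule K V k d} (hp : p ≠ 0) {c : K} {v : Fin k → V}
    (hd : d ≠ 0) (h : p.1 = c • ⨂ₜ[K] _ : Fin d, exteriorPower.ιMulti K k v) :
    Projectivization.mk K p hp ∈ grassmannian K V k d := by
  have hp' : p.1 ≠ 0 := fun h => hp (Subtype.ext h)
  have hc : c ≠ 0 := by
    rintro rfl
    exact hp' (by rw [h, zero_smul])
  refine ⟨v, ?_, ?_⟩
  · by_contra hv
    refine hp' ?_
    rw [h, (exteriorPower.ιMulti K k).map_linearDependent v hv,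
      (PiTensorProduct.tprod K).map_coord_zero (⟨0, Nat.pos_of_ne_zero hd⟩ : Fin d) rfl, smul_zero]
  · rw [Projectivization.submodule_mk, Submodule.map_span, Set.image_singleton,
      Submodule.subtype_apply, h, Submodule.span_singleton_smul_eq (IsUnit.mk0 c hc)]

theorem mem_span_of_submodule_le {p : schurModule K V k d} (hp : p ≠ 0) {r : ℕ}
    {q : Fin r → ℙ K (schurModule K V k d)} (hq : ∀ i, q i ∈ grassmannian K V k d)
    (hpq : (Projectivization.mk K p hp).submodule ≤ ⨆ i, (q i).submodule) :
    ∃ v : Fin r → Fin k → V,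
      p.1 ∈ Submodule.span K (Set.range fun i => ⨂ₜ[K] _ : Fin d, exteriorPower.ιMulti K k (v i)) := by
  choose v _ hv using hq
  refine ⟨v, ?_⟩
  rw [Submodule.span_range_eq_iSup]
  simp only [← hv, ← Submodule.map_iSup]
  refine ⟨p, hpq ?_, rfl⟩
  rw [Projectivization.submodule_mk]
  exact Submodule.mem_span_singleton_self p

/-- Contraction by a fixed `g` is linear and sends each power to a multiple of the shorter power. -/
theorem range_catalecticant_le (hd : h ≤ d) {ι : Type*} (v : ι → Fin k → V)
    {p : schurModule K V k d} (hp : p.1 ∈ Submodule.span K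
      (Set.range fun i => ⨂ₜ[K] _ : Fin d, exteriorPower.ιMulti K k (v i))) :
    LinearMap.range (catalecticant hd p) ≤ Submodule.span K
      (Set.range fun i => ⨂ₜ[K] _ : {j : Fin d // ¬ (j : ℕ) < h}, exteriorPower.ιMulti K k (v i)) := by
  rintro _ ⟨g, rfl⟩
  change columnContraction hd g.1 p.1 ∈ _
  rw [← Submodule.mem_comap]
  refine Submodule.span_le.2 ?_ hp
  rintro _ ⟨i, rfl⟩
  rw [SetLike.mem_coe, Submodule.mem_comap, columnContraction_apply, apolarityAction_tprod_const]
  exact Submodule.smul_mem _ _ (Submodule.subset_span ⟨i, rfl⟩)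

theorem finrank_le_card_of_le_span_range {W ι : Type*} [AddCommMonoid W] [Module K W] [Fintype ι]
    (w : ι → W) {S : Submodule K W} (hS : S ≤ Submodule.span K (Set.range w)) :
    Module.finrank K S ≤ Fintype.card ι := by
  let _ : AddCommGroup W := Module.addCommMonoidToAddCommGroup K
  have := FiniteDimensional.span_of_finite K (Set.finite_range w)
  exact (Submodule.finrank_mono hS).trans (finrank_range_le_card w)

theorem finrank_pos_of_le_span_range {W ι : Type*} [AddCommMonoid W] [Module K W] [Finite ι]
    (w : ι → W) {S : Submodule K W} (hS : S ≤ Submodule.span K (Set.range w)) {x : W}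
    (hxS : x ∈ S) (hx : x ≠ 0) : 0 < Module.finrank K S := by
  let _ : AddCommGroup W := Module.addCommMonoidToAddCommGroup K
  have := FiniteDimensional.span_of_finite K (Set.finite_range w)
  have := Submodule.finiteDimensional_of_le hS
  exact Module.finrank_pos_iff_exists_ne_zero.2
    ⟨⟨x, hxS⟩, fun h => hx (congrArg Subtype.val h)⟩

theorem finrank_range_catalecticant_le_xRank (p : schurModule K V k d) (hp : p ≠ 0) (hd : h ≤ d) :
    (Module.finrank K (LinearMap.range (catalecticant hd p)) : ℕ∞) ≤
      xRank (grassmannian K V k d) (Projectivization.mk K p hp) := by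
  refine le_sInf ?_
  rintro _ ⟨r, rfl, q, hq, hpq⟩
  obtain ⟨v, hv⟩ := mem_span_of_submodule_le hp hq hpq
  have := finrank_le_card_of_le_span_range _ (range_catalecticant_le hd v hv)
  rw [Fintype.card_fin] at this
  exact Nat.cast_le.2 this

theorem exists_eq_smul_of_xRank_eq_one {p : schurModule K V k d} (hp : p ≠ 0)
    (h : xRank (grassmannian K V k d) (Projectivization.mk K p hp) = 1) :
    ∃ (c : K) (v : Fin k → V), p.1 = c • ⨂ₜ[K] _ : Fin d, exteriorPower.ιMulti K k v := by
  have hne : {m : ℕ∞ | ∃ r : ℕ, m = r ∧ ∃ q : Fin r → ℙ K (schurModule K V k d),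
      (∀ i, q i ∈ grassmannian K V k d) ∧
        (Projectivization.mk K p hp).submodule ≤ ⨆ i, (q i).submodule}.Nonempty := by
    -- An empty set would have infimum `⊤`; nonemptiness makes the infimum attained.
    by_contra! hs
    rw [xRank, hs, sInf_empty] at h
    exact absurd h (by simp)
  obtain ⟨r, hr, q, hq, hpq⟩ := csInf_mem hne
  obtain rfl : r = 1 := Nat.cast_injective (hr.symm.trans (h.trans Nat.cast_one.symm))
  obtain ⟨v, hv⟩ := mem_span_of_submodule_le hp hq hpq
  rw [Set.range_unique, Submodule.mem_span_singleton] at hv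
  obtain ⟨c, hc⟩ := hv
  exact ⟨c, _, hc.symm⟩

theorem finrank_range_catalecticant_eq_one [CharZero K] [FiniteDimensional K V] (hd0 : d ≠ 0)
    {p : schurModule K V k d} (hp : p ≠ 0)
    (hr : xRank (grassmannian K V k d) (Projectivization.mk K p hp) = 1) (hd : h ≤ d) :
    Module.finrank K (LinearMap.range (catalecticant hd p)) = 1 := by
  have hle := finrank_range_catalecticant_le_xRank p hp hd
  rw [hr, Nat.cast_le_one] at hle
  refine le_antisymm hle ?_
  obtain ⟨c, v, hv⟩ := exists_eq_smul_of_xRank_eq_one hp hr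
  have hp' : p.1 ≠ 0 := fun h => hp (Subtype.ext h)
  have hw : exteriorPower.ιMulti K k v ≠ 0 := by
    intro h0
    refine hp' ?_
    rw [hv, (PiTensorProduct.tprod K).map_coord_zero
      (⟨0, Nat.pos_of_ne_zero hd0⟩ : Fin d) h0, smul_zero]
  obtain ⟨α, hα⟩ := exists_pairingDual_ne_zero hw
  have hc : c ≠ 0 := by
    rintro rfl
    exact hp' (by rw [hv, zero_smul])
  have hspan := range_catalecticant_le hd (fun _ : Unit => v) (p := p) (by
    rw [Set.range_const, hv]
    exact Submodule.smul_mem _ _ (Submodule.mem_span_singleton_self _))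
  refine finrank_pos_of_le_span_range _ hspan
    ⟨⟨_, tprod_ιMulti_mem_schurModule (d := h) α⟩, rfl⟩ fun h0 => ?_
  -- The full pairing `c * ⟨α, v⟩ ^ d` is nonzero and factors through the contraction of the first
  -- `h` columns.
  have h1 := columnPairing_tprod_eq hd (fun _ => exteriorPower.ιMulti K k α) p.1
  change apolarityAction hd p.1 (⨂ₜ[K] _, exteriorPower.ιMulti K k α) = 0 at h0
  rw [h0, map_zero, hv, map_smul, columnPairing_tprod_tprod, Finset.prod_const] at h1
  exact smul_ne_zero hc (pow_ne_zero _ hα) h1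

end Rank

end

end SchurApolarity

theorem mainTheorem5 {K : Type*} [Field K] [IsAlgClosed K] [CharZero K]
    {V : Type*} [AddCommGroup V] [Module K V] [FiniteDimensional K V]
    (k d : ℕ) (hk : 1 ≤ k) (hkV : k < Module.finrank K V) (hd : 1 ≤ d) :
    (∀ (p : schurModule K V k d) (hp : p ≠ 0),
      xRank (grassmannian K V k d) (Projectivization.mk K p hp) = 1 →
        ∀ (h : ℕ) (hh : h ≤ d / 2),
          Module.finrank K (LinearMap.range
            (catalecticant (hh.trans (Nat.div_le_self d 2)) p)) = 1) ∧
    (2 ≤ d → ∀ (p : schurModule K V k d) (hp : p ≠ 0),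
      (∀ (h : ℕ) (hh : h ≤ d / 2),
          Module.finrank K (LinearMap.range
            (catalecticant (hh.trans (Nat.div_le_self d 2)) p)) = 1) →
        xRank (grassmannian K V k d) (Projectivization.mk K p hp) = 1) ∧
    (∀ (t : schurModule K V k d) (ht : t ≠ 0) (h : ℕ) (hh : h ≤ d),
      (Module.finrank K (LinearMap.range (catalecticant hh t)) : ℕ∞) ≤
        xRank (grassmannian K V k d) (Projectivization.mk K t ht)) := by
  have hd0 : d ≠ 0 := Nat.one_le_iff_ne_zero.1 hd
  refine ⟨fun p hp hr h hh => finrank_range_catalecticant_eq_one hd0 hp hr _,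
    fun hd2 p hp H => ?_, fun t ht h hh => finrank_range_catalecticant_le_xRank t ht hh⟩
  obtain ⟨c, v, hv⟩ := exists_eq_smul_tprod_ιMulti hd2 p hp
    -- The value `h = 1` is in range because `2 ≤ d`.
    (H 1 ((Nat.one_le_div_iff two_pos).2 hd2))
  exact xRank_eq_one_of_mem (mk_mem_grassmannian hp hd0 hv)
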